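/- Setting. For real $k>1$ and $D\ge 0$ let $\mathcal P_k=\mathcal P_k(D)$ be the set of probability distributions $P$ on $\mathbb R$ with finite mean $\mu(P)=\mathbb E_{X\sim P}(X)\in[-D,D]$ and $\mathbb E_{X\sim P}|X-\mu(P)|^k\le 1$. Let $\mathcal G$ be the set of all probability distributions on $\mathbb R$ and let $\varepsilon\in[0,1]$. Let $\mathcal Z$ be any measurable space. An $\alpha$-LDP (sequentially interactive, $\alpha$-locally differentially private) mechanism $Q$ for $n$ data points with outputs in $\mathcal Z$ consists of Markov kernels $Q_i(\cdot\mid x,z_1,\dots,z_{i-1})$ on $\mathcal Z$, $i=1,\dots,n$, such that $$Q_i(A\mid x,z_1,\dots,z_{i-1})\le e^{\alpha}\,Q_i(A\mid x',z_1,\dots,z_{i-1})$$ for all $i$, all measurable $A\subseteq\mathcal Z$, all $x,x'\in\mathbb R$ and all $z_1,\dots,z_{i-1}\in\mathcal Z$; given the raw data $X_1,\dots,X_n$, the outputs $Z_1,\dots,Z_n$ are generated successively by $Z_i\sim Q_i(\cdot\mid X_i,Z_1,\dots,Z_{i-1})$. Let $\mathcal Q_\alpha$ be the set of these mechanisms.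 The minimax risk is $$\mathcal R_{n,\alpha}(\varepsilon)=\inf_{Q\in\mathcal Q_\alpha}\ \inf_{\hat\mu}\ \sup_{P\in\mathcal P_k,\ G\in\mathcal G}\ \mathbb E\big[\{\hat\mu(Z_1,\dots,Z_n)-\mu(P)\}^2\big]\in[0,\infty],$$ where $\hat\mu:\mathcal Z^n\to\mathbb R$ ranges over the measurable functions, and the expectation is taken over $X_1,\dots,X_n$ i.i.d. from $(1-\varepsilon)P+\varepsilon G$ and over the randomness of $Q$. Proposition. (i) For every $\kappa>0$ there is a constant $c>0$, depending only on $\kappa$, such that for all $\mathcal Z$, $k>1$, $D\ge1$, $\alpha\in(0,1]$, $\varepsilon\in[0,1]$ and $n\in\mathbb N$ with $n\alpha^2\ge\kappa$, $$\mathcal R_{n,\alpha}(\varepsilon)\ \ge\ c\left\{(n\alpha^2)^{1/k-1}\ \vee\ \varepsilon^{2-2/k}\ \vee\ \frac{D^2}{\exp(64n\alpha^2)}\right\}.$$ (ii) There is an absolute constant $c>0$ such that for all $\mathcal Z$, $k>1$, $D\ge1$, $\alpha\in(0,1]$, $\varepsilon\in[0,1]$ and $n\ge1$, $$\mathcal R_{n,\alpha}(\varepsilon)\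 \ge\ c\left\{\varepsilon^{2-2/k}\ \vee\ \frac{D^2}{\exp(64n\alpha^2)}\right\}.$$ (iii) For all $\mathcal Z$, $k>1$, $D\in[0,\infty)$, $\alpha\in(0,1]$ and $n\ge1$, $$\mathcal R_{n,\alpha}(0)\ \ge\ \frac{D^2}{32\exp(64n\alpha^2)}.$$ -/

import Mathlib

open MeasureTheory ProbabilityTheory
open scoped ENNReal

namespace LDPMean

noncomputable section

/-- A sequentially interactive mechanism for `n` data points: the `i`-th output is drawn from a
Markov kernel given the `i`-th raw data point and all earlier outputs (there are `i` of them, as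
indices start at `0`). -/
structure Mechanism (X Z : Type*) [MeasurableSpace X] [MeasurableSpace Z] (n : ℕ) where
  /-- The conditional distribution of the `i`-th output. -/
  step : (i : Fin n) → Kernel (X × (Fin i → Z)) Z
  /-- Each conditional distribution is a probability measure. -/
  isMarkov : ∀ i, IsMarkovKernel (step i)

variable {X Z : Type*} [MeasurableSpace X] [MeasurableSpace Z]

/-- `α`-local differential privacy. The ratio bound is written in product form, so that it has a
meaning also where the denominator vanishes. -/
def Mechanism.IsLDP {n : ℕ} (Q : Mechanism X Z n) (α : ℝ) : Prop :=
  ∀ (i : Fin n) (A : Set Z), MeasurableSet A → ∀ (z : Fin i → Z) (x x' : X),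
    Q.step i (x, z) A ≤ ENNReal.ofReal (Real.exp α) * Q.step i (x', z) A

/-- The mechanism restricted to its first `n` steps. -/
def Mechanism.init {n : ℕ} (Q : Mechanism X Z (n + 1)) : Mechanism X Z n where
  step i := Q.step i.castSucc
  isMarkov i := Q.isMarkov i.castSucc

theorem measurable_finInit (n : ℕ) :
    Measurable (fun x : Fin (n + 1) → X => (Fin.init x : Fin n → X)) :=
  measurable_pi_lambda _ fun i => measurable_pi_apply i.castSucc

theorem measurable_lastStepInput (n : ℕ) :
    Measurable (fun p : (Fin (n + 1) → X) × (Fin n → Z) => (p.1 (Fin.last n), p.2)) :=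
  ((measurable_pi_apply (Fin.last n)).comp measurable_fst).prodMk measurable_snd

theorem measurable_finSnoc (n : ℕ) :
    Measurable (fun p : (Fin n → Z) × Z => (Fin.snoc p.1 p.2 : Fin (n + 1) → Z)) := by
  refine measurable_pi_lambda _ fun i => ?_
  refine Fin.lastCases ?_ (fun j => ?_) i
  · simpa using measurable_snd
  · simpa [Function.comp_def] using
      (measurable_pi_apply (X := fun _ : Fin n => Z) j).comp (measurable_fst (β := Z))

/-- The conditional distribution of all outputs `(Z₁, …, Zₙ)` given the raw data `(x₁, …, xₙ)`:
first draw `(Z₁, …, Zₙ₋₁)` given `(x₁, …, xₙ₋₁)`, then draw `Zₙ` given `xₙ` and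
`(Z₁, …, Zₙ₋₁)`, and append it. -/
def Mechanism.output : {n : ℕ} → Mechanism X Z n → Kernel (Fin n → X) (Fin n → Z)
  | 0, _ => Kernel.const _ (Measure.dirac Fin.elim0)
  | n + 1, Q =>
      ((Q.init.output.comap (fun x : Fin (n + 1) → X => (Fin.init x : Fin n → X))
          (measurable_finInit n)) ⊗ₖ
        ((Q.step (Fin.last n)).comap
          (fun p : (Fin (n + 1) → X) × (Fin n → Z) => (p.1 (Fin.last n), p.2))
          (measurable_lastStepInput n))).map
        (fun p : (Fin n → Z) × Z => (Fin.snoc p.1 p.2 : Fin (n + 1) → Z))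

instance Mechanism.isMarkovKernel_output {n : ℕ} (Q : Mechanism X Z n) :
    IsMarkovKernel Q.output := by
  induction n with
  | zero => rw [Mechanism.output]; infer_instance
  | succ n ih =>
    rw [Mechanism.output]
    have := ih Q.init
    have := Q.isMarkov (Fin.last n)
    have := Kernel.IsMarkovKernel.comap Q.init.output (measurable_finInit (X := X) n)
    have := Kernel.IsMarkovKernel.comap (Q.step (Fin.last n))
      (measurable_lastStepInput (X := X) (Z := Z) n)
    exact Kernel.IsMarkovKernel.map _ (measurable_finSnoc n)

/-- Huber's contamination `(1 - ε) P + ε G` of the inlier distribution `P` by `G`. -/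
def huber (ε : ℝ) (P G : Measure X) : Measure X :=
  ENNReal.ofReal (1 - ε) • P + ENNReal.ofReal ε • G

/-- The mean squared error of the estimator `est`, a function of the privatised data, as an
estimator of `t`, when the raw data are `n` i.i.d. draws from `R`. -/
def meanSquaredError {n : ℕ} (Q : Mechanism X Z n) (est : (Fin n → Z) → ℝ) (R : Measure X)
    (t : ℝ) : ℝ≥0∞ :=
  ∫⁻ x, ∫⁻ z, ENNReal.ofReal ((est z - t) ^ 2) ∂(Q.output x) ∂(Measure.pi fun _ : Fin n => R)

/-- The `α`-LDP minimax squared risk under `ε`-contamination for estimating the functional `θ` of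
the inlier distribution over the class `C`, for mechanisms with outputs in `Z`. -/
def minimaxRisk (Z : Type*) [MeasurableSpace Z] (n : ℕ) (α ε : ℝ) (C : Set (Measure X))
    (θ : Measure X → ℝ) : ℝ≥0∞ :=
  ⨅ (Q : Mechanism X Z n) (_ : Q.IsLDP α) (est : (Fin n → Z) → ℝ) (_ : Measurable est),
    ⨆ (P ∈ C) (G : Measure X) (_ : IsProbabilityMeasure G),
      meanSquaredError Q est (huber ε P G) (θ P)

/-- The mean of a distribution on the real line (used for distributions with a finite mean). -/
def mean (P : Measure ℝ) : ℝ := ∫ x, x ∂P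

/-- Distributions on the real line with mean in `[-D, D]` and `k`-th central absolute moment at
most `1`. -/
def momentClass (k D : ℝ) : Set (Measure ℝ) :=
  {P | IsProbabilityMeasure P ∧ Integrable (fun x : ℝ => x) P ∧ mean P ∈ Set.Icc (-D) D ∧
    ∫⁻ x, ENNReal.ofReal (|x - mean P| ^ k) ∂P ≤ 1}

/-- The `α`-LDP minimax squared risk of mean estimation under `ε`-contamination. -/
def meanRisk (Z : Type*) [MeasurableSpace Z] (n : ℕ) (α ε k D : ℝ) : ℝ≥0∞ :=
  minimaxRisk Z n α ε (momentClass k D) mean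

end

end LDPMean

/-!
The proof is Le Cam's two-point method, with the distance between the laws of the outputs measured
by the second moment of their likelihood ratio (one plus the chi-square divergence).

* *One step.* Suppose the laws of the raw data differ by moving a mass `δ` only. Privacy makes all
  conditional output probabilities comparable up to the factor `e^α`, so the likelihood ratio of
  a single output stays within `δ (e^α - 1) ≤ 2 δ α` of `1` (`bind_huber_le`). As its mean is `1`,
  its second moment is at most `1 + 4 δ² α²` (`SecondMomentBound.of_le_smul`).
* *All steps.* The second moment bound, in the dual form `(∫ g dμ)² ≤ K ∫ g² dν`, multiplies up over
  the successive outputs (`Mechanism.IsLDP.secondMomentBound`), so that `K ≤ exp (4 n δ² α²)` for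
  the whole transcript. The dual form is used for each fixed past, so neither joint densities nor
  any assumption on the output space are needed.
* *Testing.* An estimator that is good under both laws would separate them, which the second moment
  bound forbids: the risk is at least `(θ P₀ - θ P₁)² / (16 K)`
  (`SecondMomentBound.le_max_lintegral_sq`, `le_minimaxRisk`).

The three terms come from three choices of the two points: the point masses at `D` and `-D` with
`δ = 1`; the point mass at `0` against a `spike` of mass `δ` of order `(n α²)^(-1/2)`; and the point
mass at `0` against a spike of mass `ε`, for which the contamination makes the laws of the raw data
equal.
-/

namespace LDPMean

/-! ### Second moments of likelihood ratios -/

/-- The second moment under `ν` of the likelihood ratio of `μ` with respect to `ν`, that is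
`1 + χ²(μ, ν)`, is at most `K`. This is written in its dual form, which makes sense without
densities: on a product of arbitrary measurable spaces a jointly measurable choice of conditional
densities need not exist. -/
def SecondMomentBound {Ω : Type*} [MeasurableSpace Ω] (K : ℝ≥0∞) (μ ν : Measure Ω) : Prop :=
  ∀ g : Ω → ℝ≥0∞, Measurable g → (∫⁻ ω, g ω ∂μ) ^ 2 ≤ K * ∫⁻ ω, g ω ^ 2 ∂ν

section SecondMoment

variable {Ω : Type*} [MeasurableSpace Ω] {μ ν : Measure Ω}

theorem sq_lintegral_mul_le {f g : Ω → ℝ≥0∞} (hf : Measurable f) (hg : Measurable g) :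
    (∫⁻ ω, f ω * g ω ∂μ) ^ 2 ≤ (∫⁻ ω, f ω ^ 2 ∂μ) * ∫⁻ ω, g ω ^ 2 ∂μ := by
  have h := ENNReal.lintegral_mul_le_Lp_mul_Lq μ Real.HolderConjugate.two_two
    hf.aemeasurable hg.aemeasurable
  have hs : ∀ a : ℝ≥0∞, (a ^ (1 / (2 : ℝ))) ^ 2 = a := fun a => by
    rw [← ENNReal.rpow_natCast, ← ENNReal.rpow_mul]; norm_num
  calc (∫⁻ ω, f ω * g ω ∂μ) ^ 2
      ≤ ((∫⁻ ω, f ω ^ (2 : ℝ) ∂μ) ^ (1 / (2 : ℝ)) *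
          (∫⁻ ω, g ω ^ (2 : ℝ) ∂μ) ^ (1 / (2 : ℝ))) ^ 2 := pow_le_pow_left' h 2
    _ = _ := by rw [mul_pow, hs, hs]; simp

/-- If the likelihood ratio stays within `η` of `1`, then its second moment is at most `1 + η²`,
because its mean is `1`. -/
theorem SecondMomentBound.of_le_smul [IsProbabilityMeasure μ] [IsProbabilityMeasure ν] {η : ℝ}
    (hη : 0 ≤ η) (h₁ : μ ≤ ENNReal.ofReal (1 + η) • ν) (h₂ : ν ≤ ENNReal.ofReal (1 + η) • μ) :
    SecondMomentBound (ENNReal.ofReal (1 + η ^ 2)) μ ν := by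
  intro g hg
  have hac : μ ≪ ν := (Measure.absolutelyContinuous_of_le_smul h₁)
  set s := μ.rnDeriv ν with hs
  have hsm : Measurable s := Measure.measurable_rnDeriv μ ν
  have hμ : ν.withDensity s = μ := Measure.withDensity_rnDeriv_eq μ ν hac
  have hset : ∀ A, MeasurableSet A → ∫⁻ ω in A, s ω ∂ν = μ A := fun A hA => by
    rw [← withDensity_apply _ hA, hμ]
  have hup : s ≤ᵐ[ν] fun _ => ENNReal.ofReal (1 + η) := by
    refine ae_le_of_forall_setLIntegral_le_of_sigmaFinite hsm fun A hA _ => ?_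
    rw [hset A hA, setLIntegral_const]
    simpa using h₁ A
  have hlow : (fun _ => 1 : Ω → ℝ≥0∞) ≤ᵐ[ν] fun ω => ENNReal.ofReal (1 + η) * s ω := by
    refine ae_le_of_forall_setLIntegral_le_of_sigmaFinite measurable_const fun A hA _ => ?_
    rw [lintegral_const_mul _ hsm, hset A hA, setLIntegral_const]
    simpa using h₂ A
  have hs1 : ∫⁻ ω, s ω ∂ν = 1 := by
    have := hset Set.univ MeasurableSet.univ
    simpa using this
  -- `(s - 1)² ≤ η²`, with the negative term moved to the left
  have hpt : ∀ᵐ ω ∂ν, s ω ^ 2 + 1 ≤ 2 * s ω + ENNReal.ofReal (η ^ 2) := by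
    filter_upwards [hup, hlow] with ω hu hl
    have hfin : s ω ≠ ∞ := ne_top_of_le_ne_top ENNReal.ofReal_ne_top hu
    obtain ⟨t, ht, htω⟩ : ∃ t : ℝ, 0 ≤ t ∧ s ω = ENNReal.ofReal t :=
      ⟨(s ω).toReal, ENNReal.toReal_nonneg, (ENNReal.ofReal_toReal hfin).symm⟩
    rw [htω] at hu hl ⊢
    rw [ENNReal.ofReal_le_ofReal_iff (by positivity)] at hu
    rw [← ENNReal.ofReal_mul (by positivity), ← ENNReal.ofReal_one,
      ENNReal.ofReal_le_ofReal_iff (by positivity)] at hl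
    have h2 : (2 : ℝ≥0∞) = ENNReal.ofReal 2 := by simp
    rw [← ENNReal.ofReal_one, h2, ← ENNReal.ofReal_pow ht, ← ENNReal.ofReal_mul (by norm_num),
      ← ENNReal.ofReal_add (by positivity) (by positivity),
      ← ENNReal.ofReal_add (by positivity) (by positivity)]
    refine ENNReal.ofReal_le_ofReal ?_
    have hlo : 1 - η ≤ t := by nlinarith
    nlinarith
  have hsq : ∫⁻ ω, s ω ^ 2 ∂ν ≤ ENNReal.ofReal (1 + η ^ 2) := by
    have h := lintegral_mono_ae hpt
    rw [lintegral_add_right _ measurable_const, lintegral_add_right _ measurable_const,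
      lintegral_const_mul _ hsm, hs1] at h
    simp only [lintegral_const, measure_univ, mul_one] at h
    have h2 : (2 : ℝ≥0∞) = 1 + 1 := by norm_num
    rw [h2, add_assoc, add_comm, ENNReal.add_le_add_iff_left ENNReal.one_ne_top] at h
    rwa [ENNReal.ofReal_add zero_le_one (by positivity), ENNReal.ofReal_one]
  calc (∫⁻ ω, g ω ∂μ) ^ 2 = (∫⁻ ω, s ω * g ω ∂ν) ^ 2 := by
        rw [← hμ, lintegral_withDensity_eq_lintegral_mul _ hsm hg]; rfl
    _ ≤ (∫⁻ ω, s ω ^ 2 ∂ν) * ∫⁻ ω, g ω ^ 2 ∂ν := sq_lintegral_mul_le hsm hg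
    _ ≤ _ := by gcongr

end SecondMoment

/-! ### Contraction under local differential privacy -/

section Privacy

variable {X Z : Type*} [MeasurableSpace X] [MeasurableSpace Z]

/-- The mixture `(1 - δ) P + δ G` of two probability measures is one. -/
theorem isProbabilityMeasure_huber {δ : ℝ} (h0 : 0 ≤ δ) (h1 : δ ≤ 1) (P G : Measure X)
    [IsProbabilityMeasure P] [IsProbabilityMeasure G] : IsProbabilityMeasure (huber δ P G) := by
  constructor
  simp only [huber, Measure.coe_add, Measure.coe_smul, Pi.add_apply, Pi.smul_apply, measure_univ,
    smul_eq_mul, mul_one]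
  rw [← ENNReal.ofReal_add (by linarith) h0]
  simp

theorem huber_self {δ : ℝ} (h0 : 0 ≤ δ) (h1 : δ ≤ 1) (P : Measure X) : huber δ P P = P := by
  rw [huber, ← add_smul, ← ENNReal.ofReal_add (by linarith) h0]
  simp

theorem lintegral_huber (δ : ℝ) (P G : Measure X) (f : X → ℝ≥0∞) :
    ∫⁻ x, f x ∂(huber δ P G) =
      ENNReal.ofReal (1 - δ) * ∫⁻ x, f x ∂P + ENNReal.ofReal δ * ∫⁻ x, f x ∂G := by
  rw [huber, lintegral_add_measure, lintegral_smul_measure, lintegral_smul_measure]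
  rfl

/-- Privacy contracts distances: if two input laws differ by a mass `δ` only, the output laws have a
likelihood ratio of at most `1 + δ (e^α - 1)`, because the two outputs produced by the differing
mass differ by at most `e^α - 1` times the smallest output probability. -/
theorem bind_huber_le {κ : Kernel X Z} {α δ : ℝ} (hα : 0 ≤ α) (h0 : 0 ≤ δ)
    (h1 : δ ≤ 1) (hκ : ∀ A, MeasurableSet A → ∀ x x', κ x A ≤ ENNReal.ofReal (Real.exp α) * κ x' A)
    (N P₀ P₁ : Measure X) [IsProbabilityMeasure N] [IsProbabilityMeasure P₀]
    [IsProbabilityMeasure P₁] [IsMarkovKernel κ] :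
    (huber δ N P₀).bind κ ≤
      ENNReal.ofReal (1 + δ * (Real.exp α - 1)) • (huber δ N P₁).bind κ := by
  refine Measure.le_iff.2 fun A hA => ?_
  have he : 1 ≤ Real.exp α := Real.one_le_exp hα
  rw [Measure.smul_apply, smul_eq_mul, Measure.bind_apply hA κ.aemeasurable,
    Measure.bind_apply hA κ.aemeasurable, lintegral_huber, lintegral_huber]
  -- every output probability is at least `e^{-α}` times the average over `P₀`
  have hbd : ∀ (P : Measure X) [IsProbabilityMeasure P],
      ∫⁻ x, κ x A ∂P₀ ≤ ENNReal.ofReal (Real.exp α) * ∫⁻ x, κ x A ∂P := by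
    intro P _
    rw [← lintegral_const_mul _ (κ.measurable_coe hA)]
    have h : ∀ x', ∫⁻ x, κ x A ∂P₀ ≤ ENNReal.ofReal (Real.exp α) * κ x' A := fun x' => by
      calc ∫⁻ x, κ x A ∂P₀ ≤ ∫⁻ _, ENNReal.ofReal (Real.exp α) * κ x' A ∂P₀ :=
            lintegral_mono fun x => hκ A hA x x'
        _ = _ := by simp
    calc ∫⁻ x, κ x A ∂P₀ = ∫⁻ _, ∫⁻ x, κ x A ∂P₀ ∂P := by simp
      _ ≤ _ := lintegral_mono h
  have hfin : ∀ (P : Measure X) [IsProbabilityMeasure P],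
      ∃ t : ℝ, 0 ≤ t ∧ ∫⁻ x, κ x A ∂P = ENNReal.ofReal t := fun P _ => by
    refine ⟨(∫⁻ x, κ x A ∂P).toReal, ENNReal.toReal_nonneg, (ENNReal.ofReal_toReal ?_).symm⟩
    refine ne_top_of_le_ne_top ENNReal.one_ne_top ?_
    calc ∫⁻ x, κ x A ∂P ≤ ∫⁻ _, 1 ∂P := lintegral_mono fun x => prob_le_one
      _ = 1 := by simp
  have hb1 := hbd P₁
  have hbN := hbd N
  obtain ⟨a, ha, haN⟩ := hfin N
  obtain ⟨b, hb, hbP⟩ := hfin P₀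
  obtain ⟨c, hc, hcP⟩ := hfin P₁
  have hδ' : 0 ≤ 1 - δ := by linarith
  have hη : 0 ≤ 1 + δ * (Real.exp α - 1) := by
    have := mul_nonneg h0 (sub_nonneg.2 he); linarith
  rw [hbP, hcP] at hb1
  rw [hbP, haN] at hbN
  rw [haN, hbP, hcP]
  rw [← ENNReal.ofReal_mul (by positivity), ENNReal.ofReal_le_ofReal_iff (by positivity)] at hb1 hbN
  rw [← ENNReal.ofReal_mul hδ', ← ENNReal.ofReal_mul h0, ← ENNReal.ofReal_mul h0,
    ← ENNReal.ofReal_add (by positivity) (by positivity),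
    ← ENNReal.ofReal_add (by positivity) (by positivity), ← ENNReal.ofReal_mul hη]
  refine ENNReal.ofReal_le_ofReal ?_
  set u := b / Real.exp α with hu
  have hbu : b = Real.exp α * u := by rw [hu]; field_simp
  have hua : u ≤ a := by rw [hu, div_le_iff₀ (by positivity)]; linarith
  have huc : u ≤ c := by rw [hu, div_le_iff₀ (by positivity)]; linarith
  have hmix : u ≤ (1 - δ) * a + δ * c := by nlinarith
  have h2 : δ * (Real.exp α - 1) * u ≤ δ * (Real.exp α - 1) * ((1 - δ) * a + δ * c) :=
    mul_le_mul_of_nonneg_left hmix (mul_nonneg h0 (sub_nonneg.2 he))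
  have h3 := mul_le_mul_of_nonneg_left huc h0
  rw [hbu]
  linarith

theorem secondMomentBound_bind_huber {κ : Kernel X Z} [IsMarkovKernel κ] {α δ : ℝ} (hα : 0 ≤ α)
    (h0 : 0 ≤ δ) (h1 : δ ≤ 1)
    (hκ : ∀ A, MeasurableSet A → ∀ x x', κ x A ≤ ENNReal.ofReal (Real.exp α) * κ x' A)
    (N P₀ P₁ : Measure X) [IsProbabilityMeasure N] [IsProbabilityMeasure P₀]
    [IsProbabilityMeasure P₁] :
    SecondMomentBound (ENNReal.ofReal (1 + (δ * (Real.exp α - 1)) ^ 2))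
      ((huber δ N P₀).bind κ) ((huber δ N P₁).bind κ) := by
  have := isProbabilityMeasure_huber h0 h1 N P₀
  have := isProbabilityMeasure_huber h0 h1 N P₁
  exact .of_le_smul (mul_nonneg h0 (sub_nonneg.2 (Real.one_le_exp hα)))
    (bind_huber_le hα h0 h1 hκ N P₀ P₁) (bind_huber_le hα h0 h1 hκ N P₁ P₀)

end Privacy

/-! ### The law of the transcript -/

section Transcript

variable {X Z : Type*} [MeasurableSpace X] [MeasurableSpace Z]

/-- The law of the outputs of a mechanism applied to `n` independent draws from `ρ`. -/
noncomputable def Mechanism.outputLaw {n : ℕ} (Q : Mechanism X Z n) (ρ : Measure X) :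
    Measure (Fin n → Z) :=
  (Measure.pi fun _ : Fin n => ρ).bind Q.output

instance {n : ℕ} (Q : Mechanism X Z n) (ρ : Measure X) [IsProbabilityMeasure ρ] :
    IsProbabilityMeasure (Q.outputLaw ρ) := by
  unfold Mechanism.outputLaw; infer_instance

theorem Mechanism.lintegral_outputLaw {n : ℕ} (Q : Mechanism X Z n) (ρ : Measure X)
    {g : (Fin n → Z) → ℝ≥0∞} (hg : Measurable g) :
    ∫⁻ z, g z ∂(Q.outputLaw ρ) =
      ∫⁻ x, ∫⁻ z, g z ∂(Q.output x) ∂(Measure.pi fun _ : Fin n => ρ) :=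
  Measure.lintegral_bind Q.output.aemeasurable hg.aemeasurable

theorem meanSquaredError_eq {n : ℕ} (Q : Mechanism X Z n) {est : (Fin n → Z) → ℝ}
    (hest : Measurable est) (ρ : Measure X) (t : ℝ) :
    meanSquaredError Q est ρ t = ∫⁻ z, ENNReal.ofReal ((est z - t) ^ 2) ∂(Q.outputLaw ρ) :=
  (Q.lintegral_outputLaw ρ (by fun_prop)).symm

theorem Mechanism.measurable_lintegral_lastStep {n : ℕ} (Q : Mechanism X Z (n + 1))
    {g : (Fin (n + 1) → Z) → ℝ≥0∞} (hg : Measurable g) :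
    Measurable fun p : X × (Fin n → Z) =>
      ∫⁻ w, g (Fin.snoc p.2 w) ∂(Q.step (Fin.last n) p) :=
  have := Q.isMarkov (Fin.last n)
  Measurable.lintegral_kernel_prod_right'
    (f := fun q : (X × (Fin n → Z)) × Z => g (Fin.snoc q.1.2 q.2))
    ((hg.comp (measurable_finSnoc n)).comp
      ((measurable_snd.comp measurable_fst).prodMk measurable_snd))

/-- The last output, averaged over the last data point, given the earlier outputs. The earlier data
points are independent of the last one, so it may be averaged out first. -/
theorem Mechanism.lintegral_outputLaw_succ {n : ℕ} (Q : Mechanism X Z (n + 1)) (ρ : Measure X)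
    [IsProbabilityMeasure ρ] {g : (Fin (n + 1) → Z) → ℝ≥0∞} (hg : Measurable g) :
    ∫⁻ z, g z ∂(Q.outputLaw ρ) =
      ∫⁻ z, ∫⁻ w, g (Fin.snoc z w)
        ∂(ρ.bind ((Q.step (Fin.last n)).comap (fun x => (x, z)) measurable_prodMk_right))
        ∂(Q.init.outputLaw ρ) := by
  have := Q.isMarkov (Fin.last n)
  have hgs : Measurable fun p : (Fin n → Z) × Z => g (Fin.snoc p.1 p.2) :=
    hg.comp (measurable_finSnoc n)
  have hgz : ∀ z : Fin n → Z, Measurable fun w => g (Fin.snoc z w) := fun z =>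
    hgs.comp measurable_prodMk_left
  have hF := Q.measurable_lintegral_lastStep hg
  have hout : ∀ x : Fin (n + 1) → X, ∫⁻ z, g z ∂(Q.output x) =
      ∫⁻ z, ∫⁻ w, g (Fin.snoc z w) ∂(Q.step (Fin.last n) (x (Fin.last n), z))
        ∂(Q.init.output (Fin.init x)) := fun x => by
    have := Kernel.IsMarkovKernel.comap Q.init.output (measurable_finInit (X := X) n)
    have := Kernel.IsMarkovKernel.comap (Q.step (Fin.last n))
      (measurable_lastStepInput (X := X) (Z := Z) n)
    rw [Mechanism.output, Kernel.lintegral_map _ (measurable_finSnoc n) _ hg,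
      Kernel.lintegral_compProd _ _ _ hgs]
    rfl
  have hinner : ∀ z : Fin n → Z, ∫⁻ w, g (Fin.snoc z w)
        ∂(ρ.bind ((Q.step (Fin.last n)).comap (fun x => (x, z)) measurable_prodMk_right)) =
      ∫⁻ x, ∫⁻ w, g (Fin.snoc z w) ∂(Q.step (Fin.last n) (x, z)) ∂ρ := fun z =>
    Measure.lintegral_bind (Kernel.aemeasurable _) (hgz z).aemeasurable
  have hG : Measurable fun z : Fin n → Z =>
      ∫⁻ x, ∫⁻ w, g (Fin.snoc z w) ∂(Q.step (Fin.last n) (x, z)) ∂ρ :=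
    hF.lintegral_prod_left'
  simp_rw [hinner]
  rw [Q.lintegral_outputLaw ρ hg, Q.init.lintegral_outputLaw ρ hG]
  simp_rw [hout]
  have hH : Measurable fun p : X × (Fin n → X) =>
      ∫⁻ z, ∫⁻ w, g (Fin.snoc z w) ∂(Q.step (Fin.last n) (p.1, z)) ∂(Q.init.output p.2) :=
    Measurable.lintegral_kernel_prod_right'
      (κ := Q.init.output.comap (Prod.snd : X × (Fin n → X) → _) measurable_snd)
      (f := fun q : (X × (Fin n → X)) × (Fin n → Z) =>
        ∫⁻ w, g (Fin.snoc q.2 w) ∂(Q.step (Fin.last n) (q.1.1, q.2)))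
      (hF.comp ((measurable_fst.comp measurable_fst).prodMk measurable_snd))
  have hmp := measurePreserving_piFinSuccAbove (fun _ : Fin (n + 1) => ρ) (Fin.last n)
  have hsplit := hmp.lintegral_comp hH
  simp only [MeasurableEquiv.piFinSuccAbove_apply, Fin.insertNthEquiv_symm_apply,
    Fin.removeNth_last] at hsplit
  rw [hsplit, lintegral_prod_symm' _ hH]
  refine lintegral_congr fun x => ?_
  exact lintegral_lintegral_swap (μ := ρ) (ν := Q.init.output x)
    (f := fun y z => ∫⁻ w, g (Fin.snoc z w) ∂(Q.step (Fin.last n) (y, z))) hF.aemeasurable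

theorem Mechanism.IsLDP.init {n : ℕ} {Q : Mechanism X Z (n + 1)} {α : ℝ} (hQ : Q.IsLDP α) :
    Q.init.IsLDP α := fun i => hQ i.castSucc

/-- The second moment bound of the single steps multiplies up over the steps. -/
theorem Mechanism.IsLDP.secondMomentBound {n : ℕ} {Q : Mechanism X Z n} {α δ : ℝ}
    (hQ : Q.IsLDP α) (hα : 0 ≤ α) (h0 : 0 ≤ δ) (h1 : δ ≤ 1)
    (N P₀ P₁ : Measure X) [IsProbabilityMeasure N] [IsProbabilityMeasure P₀]
    [IsProbabilityMeasure P₁] :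
    SecondMomentBound (ENNReal.ofReal (1 + (δ * (Real.exp α - 1)) ^ 2) ^ n)
      (Q.outputLaw (huber δ N P₀)) (Q.outputLaw (huber δ N P₁)) := by
  have := isProbabilityMeasure_huber h0 h1 N P₀
  have := isProbabilityMeasure_huber h0 h1 N P₁
  induction n with
  | zero =>
    intro g hg
    have h : ∀ (ρ : Measure X) [IsProbabilityMeasure ρ] (f : (Fin 0 → Z) → ℝ≥0∞),
        ∫⁻ z, f z ∂(Q.outputLaw ρ) = f Fin.elim0 := fun ρ _ f => by
      have hf : f = fun _ => f Fin.elim0 := funext fun z => congrArg f (Subsingleton.elim _ _)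
      rw [hf]; simp
    rw [h, h]; simp
  | succ n ih =>
    intro g hg
    have := Q.isMarkov (Fin.last n)
    set K := ENNReal.ofReal (1 + (δ * (Real.exp α - 1)) ^ 2)
    let κ : (Fin n → Z) → Kernel X Z := fun z =>
      (Q.step (Fin.last n)).comap (fun x => (x, z)) measurable_prodMk_right
    have hstep : ∀ z, SecondMomentBound K ((huber δ N P₀).bind (κ z))
        ((huber δ N P₁).bind (κ z)) := fun z =>
      have : IsMarkovKernel (κ z) := Kernel.IsMarkovKernel.comap _ measurable_prodMk_right
      secondMomentBound_bind_huber hα h0 h1 (fun A hA x x' => hQ (Fin.last n) A hA z x x') N P₀ P₁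
    have hgs : Measurable fun p : (Fin n → Z) × Z => g (Fin.snoc p.1 p.2) :=
      hg.comp (measurable_finSnoc n)
    have hmeas : Measurable fun z => ∫⁻ w, g (Fin.snoc z w) ∂((huber δ N P₀).bind (κ z)) := by
      have h : ∀ z, ∫⁻ w, g (Fin.snoc z w) ∂((huber δ N P₀).bind (κ z)) =
          ∫⁻ x, ∫⁻ w, g (Fin.snoc z w) ∂(Q.step (Fin.last n) (x, z)) ∂(huber δ N P₀) := fun z =>
        Measure.lintegral_bind (Kernel.aemeasurable _)
          (hgs.comp measurable_prodMk_left).aemeasurable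
      simp_rw [h]
      exact (Q.measurable_lintegral_lastStep hg).lintegral_prod_left'
    rw [Q.lintegral_outputLaw_succ _ hg, Q.lintegral_outputLaw_succ _ (hg.pow_const 2)]
    calc (∫⁻ z, ∫⁻ w, g (Fin.snoc z w) ∂((huber δ N P₀).bind (κ z))
            ∂(Q.init.outputLaw (huber δ N P₀))) ^ 2
        ≤ K ^ n * ∫⁻ z, (∫⁻ w, g (Fin.snoc z w) ∂((huber δ N P₀).bind (κ z))) ^ 2
            ∂(Q.init.outputLaw (huber δ N P₁)) := ih hQ.init _ hmeas
      _ ≤ K ^ n * ∫⁻ z, K * ∫⁻ w, g (Fin.snoc z w) ^ 2 ∂((huber δ N P₁).bind (κ z))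
            ∂(Q.init.outputLaw (huber δ N P₁)) := by
          gcongr with z
          exact hstep z _ (hgs.comp measurable_prodMk_left)
      _ = _ := by
          rw [lintegral_const_mul' _ _ ENNReal.ofReal_ne_top, pow_succ K n, mul_assoc]

end Transcript

/-! ### The two-point method -/

section TwoPoint

/-- Le Cam's two-point bound. If both errors were smaller, the test that decides for the nearer of
the two parameters would have error probabilities below `1 / (4 K)` under both laws, while the
second moment bound does not allow an event of probability at least `3/4` under `μ₀` to have a
probability below `1 / (4 K)` under `μ₁`. -/
theorem SecondMomentBound.le_max_lintegral_sq {Ω : Type*} [MeasurableSpace Ω] {μ₀ μ₁ : Measure Ω}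
    [IsProbabilityMeasure μ₀] [IsProbabilityMeasure μ₁] {K : ℝ} (hK : 1 ≤ K)
    (h : SecondMomentBound (ENNReal.ofReal K) μ₀ μ₁) {est : Ω → ℝ} (hest : Measurable est)
    (t₀ t₁ : ℝ) :
    ENNReal.ofReal ((t₀ - t₁) ^ 2 / (16 * K)) ≤
      max (∫⁻ ω, ENNReal.ofReal ((est ω - t₀) ^ 2) ∂μ₀)
        (∫⁻ ω, ENNReal.ofReal ((est ω - t₁) ^ 2) ∂μ₁) := by
  by_contra hlt
  rw [not_le, max_lt_iff] at hlt
  obtain ⟨hlt₀, hlt₁⟩ := hlt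
  set A : Set Ω := {ω | (est ω - t₁) ^ 2 ≤ (est ω - t₀) ^ 2} with hAdef
  have hA : MeasurableSet A := measurableSet_le (by fun_prop) (by fun_prop)
  have markov : ∀ (μ : Measure Ω) [IsProbabilityMeasure μ] (B : Set Ω) (t : ℝ),
      (∀ ω ∈ B, (t₀ - t₁) ^ 2 / 4 ≤ (est ω - t) ^ 2) →
      ∫⁻ ω, ENNReal.ofReal ((est ω - t) ^ 2) ∂μ < ENNReal.ofReal ((t₀ - t₁) ^ 2 / (16 * K)) →
      MeasurableSet B → (t₀ - t₁) ^ 2 / 4 * μ.real B < (t₀ - t₁) ^ 2 / (16 * K) := by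
    intro μ _ B t hB hlt hBm
    have h1 : ENNReal.ofReal ((t₀ - t₁) ^ 2 / 4) * μ B ≤
        ∫⁻ ω, ENNReal.ofReal ((est ω - t) ^ 2) ∂μ := by
      rw [← setLIntegral_const]
      refine (setLIntegral_mono' hBm fun ω hω => ENNReal.ofReal_le_ofReal (hB ω hω)).trans ?_
      exact setLIntegral_le_lintegral _ _
    have h2 := h1.trans_lt hlt
    rw [← ofReal_measureReal, ← ENNReal.ofReal_mul (by positivity)] at h2
    exact (ENNReal.ofReal_lt_ofReal_iff_of_nonneg (by positivity)).1 h2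
  have h₀ := markov μ₀ A t₀ (fun ω hω => by
    have : (est ω - t₁) ^ 2 ≤ (est ω - t₀) ^ 2 := hω
    nlinarith [sq_nonneg ((est ω - t₁) + (est ω - t₀))]) hlt₀ hA
  have h₁ := markov μ₁ Aᶜ t₁ (fun ω hω => by
    have : (est ω - t₀) ^ 2 ≤ (est ω - t₁) ^ 2 :=
      (not_le.1 (show ¬(est ω - t₁) ^ 2 ≤ (est ω - t₀) ^ 2 from hω)).le
    nlinarith [sq_nonneg ((est ω - t₁) + (est ω - t₀))]) hlt₁ hA.compl
  have hK0 : 0 < K := by linarith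
  have hΔ : 0 < (t₀ - t₁) ^ 2 := by
    rcases (sq_nonneg (t₀ - t₁)).eq_or_lt with h0 | h0
    · rw [← h0] at h₀; simp at h₀
    · exact h0
  have hp : ∀ p : ℝ, (t₀ - t₁) ^ 2 / 4 * p < (t₀ - t₁) ^ 2 / (16 * K) → K * p < 1 / 4 := by
    intro p hp
    rw [lt_div_iff₀ (by positivity)] at hp
    have : (t₀ - t₁) ^ 2 * (4 * (K * p)) < (t₀ - t₁) ^ 2 * 1 := by linarith
    have := lt_of_mul_lt_mul_left this hΔ.le
    linarith
  have hp₀ := hp _ h₀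
  have hp₁ := hp _ h₁
  have hind := h (Aᶜ.indicator 1) (measurable_one.indicator hA.compl)
  have hi : (fun ω => (Aᶜ.indicator (1 : Ω → ℝ≥0∞) ω) ^ 2) = Aᶜ.indicator 1 := by
    funext ω
    by_cases hω : ω ∈ Aᶜ <;> simp [hω]
  rw [hi, lintegral_indicator_one hA.compl, lintegral_indicator_one hA.compl,
    ← ofReal_measureReal, ← ofReal_measureReal, ← ENNReal.ofReal_pow measureReal_nonneg,
    ← ENNReal.ofReal_mul hK0.le,
    ENNReal.ofReal_le_ofReal_iff (mul_nonneg hK0.le measureReal_nonneg),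
    probReal_compl_eq_one_sub hA] at hind
  have hn : 0 ≤ μ₀.real A := measureReal_nonneg
  nlinarith

/-- The two-point bound for private mechanisms: the contaminated laws may differ by a mass `δ`, and
the price of telling them apart is exponential in `n δ² α²`. -/
theorem le_minimaxRisk {X Z : Type*} [MeasurableSpace X] [MeasurableSpace Z] {n : ℕ} {α ε δ : ℝ}
    (hα : 0 ≤ α) (hα1 : α ≤ 1) (h0 : 0 ≤ δ) (h1 : δ ≤ 1) {C : Set (Measure X)} {θ : Measure X → ℝ}
    {P₀ P₁ G₀ G₁ N S₀ S₁ : Measure X} (hP₀ : P₀ ∈ C) (hP₁ : P₁ ∈ C)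
    [IsProbabilityMeasure G₀] [IsProbabilityMeasure G₁] [IsProbabilityMeasure N]
    [IsProbabilityMeasure S₀] [IsProbabilityMeasure S₁]
    (h₀ : huber ε P₀ G₀ = huber δ N S₀) (h₁ : huber ε P₁ G₁ = huber δ N S₁) :
    ENNReal.ofReal ((θ P₀ - θ P₁) ^ 2 / (16 * Real.exp (4 * n * δ ^ 2 * α ^ 2))) ≤
      minimaxRisk Z n α ε C θ := by
  refine le_iInf fun Q => le_iInf fun hQ => le_iInf fun est => le_iInf fun hest => ?_
  have := isProbabilityMeasure_huber h0 h1 N S₀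
  have := isProbabilityMeasure_huber h0 h1 N S₁
  set b := 1 + (δ * (Real.exp α - 1)) ^ 2 with hb
  have hb1 : 1 ≤ b := by rw [hb]; nlinarith [sq_nonneg (δ * (Real.exp α - 1))]
  have hbn : b ^ n ≤ Real.exp (4 * n * δ ^ 2 * α ^ 2) := by
    have he : Real.exp α - 1 ≤ 2 * α := by
      have := Real.abs_exp_sub_one_le (x := α) (by rwa [abs_of_nonneg hα])
      rw [abs_of_nonneg hα] at this
      exact (le_abs_self _).trans this
    have he0 : 0 ≤ Real.exp α - 1 := sub_nonneg.2 (Real.one_le_exp hα)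
    have hsq : (δ * (Real.exp α - 1)) ^ 2 ≤ 4 * δ ^ 2 * α ^ 2 := by
      calc (δ * (Real.exp α - 1)) ^ 2 ≤ (δ * (2 * α)) ^ 2 := by gcongr
        _ = _ := by ring
    calc b ^ n ≤ Real.exp (4 * δ ^ 2 * α ^ 2) ^ n := by
          refine pow_le_pow_left₀ (by linarith) ?_ n
          have := Real.add_one_le_exp (4 * δ ^ 2 * α ^ 2)
          rw [hb]; linarith
      _ = _ := by rw [← Real.exp_nat_mul]; ring_nf
  have hSM := hQ.secondMomentBound hα h0 h1 N S₀ S₁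
  rw [← ENNReal.ofReal_pow (by linarith)] at hSM
  have hlow := hSM.le_max_lintegral_sq (one_le_pow₀ hb1) hest (θ P₀) (θ P₁)
  rw [← meanSquaredError_eq Q hest, ← meanSquaredError_eq Q hest, ← h₀, ← h₁] at hlow
  have hbpos : 0 < b ^ n := by positivity
  refine (ENNReal.ofReal_le_ofReal ?_).trans (hlow.trans (max_le ?_ ?_))
  · gcongr
  · exact le_iSup₂_of_le P₀ hP₀ (le_iSup₂_of_le G₀ inferInstance le_rfl)
  · exact le_iSup₂_of_le P₁ hP₁ (le_iSup₂_of_le G₁ inferInstance le_rfl)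

end TwoPoint

/-! ### Point masses and spikes -/

section Moments

theorem dirac_mem_momentClass {k D a : ℝ} (hk : 1 < k) (ha : |a| ≤ D) :
    Measure.dirac a ∈ momentClass k D := by
  have hm : mean (Measure.dirac a) = a := by simp [mean]
  refine ⟨inferInstance, integrable_dirac (by simp), ?_, ?_⟩
  · rw [hm]; exact abs_le.1 ha
  · rw [hm, lintegral_dirac]
    simp [Real.zero_rpow (by linarith : k ≠ 0)]

theorem mean_huber {δ : ℝ} (h0 : 0 ≤ δ) (h1 : δ ≤ 1) {P G : Measure ℝ}
    (hP : Integrable (fun x : ℝ => x) P) (hG : Integrable (fun x : ℝ => x) G) :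
    mean (huber δ P G) = (1 - δ) * mean P + δ * mean G := by
  rw [mean, huber, integral_add_measure (hP.smul_measure ENNReal.ofReal_ne_top)
    (hG.smul_measure ENNReal.ofReal_ne_top), integral_smul_measure, integral_smul_measure,
    ENNReal.toReal_ofReal (by linarith), ENNReal.toReal_ofReal h0]
  rfl

/-- The two-point distribution that moves a mass `δ` from `0` to `δ^(-1/k) / 2`, which is, up to the
factor, as far as the bound on the `k`-th moment allows. -/
noncomputable def spike (k δ : ℝ) : Measure ℝ :=
  huber δ (Measure.dirac 0) (Measure.dirac (δ ^ (-1 / k) / 2))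

theorem mean_spike {k δ : ℝ} (h0 : 0 < δ) (h1 : δ ≤ 1) :
    mean (spike k δ) = δ ^ (1 - 1 / k) / 2 := by
  rw [spike, mean_huber h0.le h1 (integrable_dirac (by simp)) (integrable_dirac (by simp))]
  simp only [mean, integral_dirac]
  have : δ ^ (1 - 1 / k) = δ * δ ^ (-1 / k) := by
    rw [sub_eq_add_neg, Real.rpow_add h0, Real.rpow_one, neg_div]
  rw [this]; ring

theorem spike_mem_momentClass {k D δ : ℝ} (hk : 1 < k) (hD : 1 ≤ D) (h0 : 0 < δ) (h1 : δ ≤ 1) :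
    spike k δ ∈ momentClass k D := by
  have hmean := mean_spike (k := k) h0 h1
  have hk0 : 0 < k := by linarith
  have hk1 : 1 / k ≤ 1 := by rw [div_le_one hk0]; exact hk.le
  have hm0 : 0 ≤ mean (spike k δ) := by rw [hmean]; positivity
  have hm1 : mean (spike k δ) ≤ 1 / 2 := by
    have := Real.rpow_le_one h0.le h1 (sub_nonneg.2 hk1)
    rw [hmean]; linarith
  refine ⟨isProbabilityMeasure_huber h0.le h1 _ _, ?_, ⟨by linarith, by linarith⟩, ?_⟩
  · exact ((integrable_dirac (by simp)).smul_measure ENNReal.ofReal_ne_top).add_measure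
      ((integrable_dirac (by simp)).smul_measure ENNReal.ofReal_ne_top)
  set m := mean (spike k δ) with hmdef
  have hhalf : ((1 : ℝ) / 2) ^ k ≤ 1 / 2 := by
    simpa using Real.rpow_le_rpow_of_exponent_ge (x := (1 : ℝ) / 2) (by norm_num) (by norm_num)
      hk.le
  set b := δ ^ (-1 / k) / 2 with hb
  have hb0 : 0 ≤ b := by positivity
  have hmb : m = δ * b := by
    rw [hmdef, spike, mean_huber h0.le h1 (integrable_dirac (by simp)) (integrable_dirac (by simp))]
    simp [mean, hb]
  have hbk : δ * b ^ k = (1 / 2) ^ k := by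
    rw [hb, div_eq_mul_one_div, Real.mul_rpow (by positivity) (by norm_num), ← Real.rpow_mul h0.le,
      div_mul_cancel₀ _ hk0.ne', Real.rpow_neg_one]
    field_simp
  have hA : |0 - m| ^ k ≤ 1 / 2 := by
    rw [zero_sub, abs_neg, abs_of_nonneg hm0]
    exact (Real.rpow_le_rpow hm0 hm1 hk0.le).trans hhalf
  have hB : δ * |b - m| ^ k ≤ 1 / 2 := by
    have hle : |b - m| ≤ b := by
      rw [hmb, abs_of_nonneg (by nlinarith)]
      have := mul_nonneg h0.le hb0
      linarith
    calc δ * |b - m| ^ k ≤ δ * b ^ k := by gcongr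
      _ ≤ 1 / 2 := hbk.trans_le hhalf
  rw [spike, lintegral_huber, lintegral_dirac, lintegral_dirac,
    ← ENNReal.ofReal_mul (by linarith), ← ENNReal.ofReal_mul h0.le,
    ← ENNReal.ofReal_add (mul_nonneg (by linarith) (by positivity)) (by positivity),
    ENNReal.ofReal_le_one]
  have hA' : (1 - δ) * |0 - m| ^ k ≤ 1 / 2 := by
    have : 0 ≤ |0 - m| ^ k := by positivity
    nlinarith
  linarith

end Moments

/-! ### The three lower bounds -/

section Bounds

variable {Z : Type*} [MeasurableSpace Z] {n : ℕ} {k D α ε : ℝ}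

/-- The cost of locating the mean within `[-D, D]`: the point masses at the two ends. -/
theorem range_le_meanRisk (hk : 1 < k) (hD : 0 ≤ D) (hα : 0 ≤ α) (hα1 : α ≤ 1) (hε : 0 ≤ ε)
    (hε1 : ε ≤ 1) :
    ENNReal.ofReal (D ^ 2 / (4 * Real.exp (4 * n * α ^ 2))) ≤ meanRisk Z n α ε k D := by
  have hone : ∀ a : ℝ, huber ε (Measure.dirac a) (Measure.dirac a) =
      huber 1 (Measure.dirac 0) (Measure.dirac a) := fun a => by
    rw [huber_self hε hε1]; simp [huber]
  have h := le_minimaxRisk (Z := Z) (n := n) (θ := mean) hα hα1 zero_le_one le_rfl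
    (dirac_mem_momentClass hk (abs_of_nonneg hD).le)
    (dirac_mem_momentClass (a := -D) hk (by rw [abs_neg, abs_of_nonneg hD]))
    (hone D) (hone (-D))
  have hm : ∀ a : ℝ, mean (Measure.dirac a) = a := fun a => by simp [mean]
  rw [hm, hm] at h
  rw [meanRisk]
  convert h using 2
  rw [one_pow, mul_one]
  field_simp
  ring

/-- The cost of contamination: the contamination can hide a spike of mass `ε` completely. -/
theorem contamination_le_meanRisk (hk : 1 < k) (hD : 1 ≤ D) (hα : 0 ≤ α) (hα1 : α ≤ 1)
    (hε : 0 ≤ ε) (hε1 : ε ≤ 1) :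
    ENNReal.ofReal (ε ^ (2 - 2 / k) / 64) ≤ meanRisk Z n α ε k D := by
  have hk0 : 0 < k := by linarith
  have hk2 : 0 < 2 - 2 / k := by
    rw [sub_pos, div_lt_iff₀ hk0]; linarith
  rcases hε.eq_or_lt with rfl | hpos
  · simp [Real.zero_rpow hk2.ne']
  set b := ε ^ (-1 / k) / 2 with hb
  have := isProbabilityMeasure_huber hε hε1 (Measure.dirac b) (Measure.dirac 0)
  have hS := (spike_mem_momentClass hk hD hpos hε1).1
  have hε' : 0 ≤ 1 - ε := by linarith
  have hR := isProbabilityMeasure_huber hε hε1 (spike k ε) (Measure.dirac 0)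
  -- both contaminated laws have the mass `ε (1 - ε)` at `b` and the remaining mass at `0`
  have hsame : huber ε (Measure.dirac 0) (huber ε (Measure.dirac b) (Measure.dirac 0)) =
      huber ε (spike k ε) (Measure.dirac 0) := by
    refine Measure.ext fun A _ => ?_
    simp only [spike, huber, ← hb, Measure.coe_add, Measure.coe_smul, Pi.add_apply, Pi.smul_apply,
      smul_eq_mul]
    set p := ENNReal.ofReal (1 - ε)
    set q := ENNReal.ofReal ε
    have hpq : p + q = 1 := by
      rw [← ENNReal.ofReal_add hε' hε]; simp
    calc p * Measure.dirac 0 A + q * (p * Measure.dirac b A + q * Measure.dirac 0 A)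
        = p * (p + q) * Measure.dirac 0 A + q * p * Measure.dirac b A
            + q * q * Measure.dirac 0 A := by rw [hpq]; ring
      _ = p * (p * Measure.dirac 0 A + q * Measure.dirac b A)
            + q * (p + q) * Measure.dirac 0 A := by ring
      _ = _ := by rw [hpq, mul_one]
  have hzero : ∀ P : Measure ℝ, huber 0 P P = P := huber_self le_rfl zero_le_one
  have h := le_minimaxRisk (Z := Z) (n := n) (θ := mean) hα hα1 le_rfl zero_le_one
    (dirac_mem_momentClass (a := 0) hk (by rw [abs_zero]; linarith))
    (spike_mem_momentClass hk hD hpos hε1) (hsame.trans (hzero _).symm) (hzero _).symm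
  rw [mean_spike hpos hε1] at h
  rw [meanRisk]
  convert h using 2
  have : ε ^ (2 - 2 / k) = (ε ^ (1 - 1 / k)) ^ 2 := by
    rw [← Real.rpow_mul_natCast hε]; congr 1; push_cast; ring
  rw [this]
  simp [mean]
  ring

/-- The cost of privacy: a spike of mass of order `(n α²)^(-1/2)` cannot be detected. -/
theorem privacy_le_meanRisk {κ : ℝ} (hκ : 0 < κ) (hk : 1 < k) (hD : 1 ≤ D) (hα : 0 ≤ α)
    (hα1 : α ≤ 1) (hε : 0 ≤ ε) (hε1 : ε ≤ 1) (hn : κ ≤ n * α ^ 2) :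
    ENNReal.ofReal (min κ 1 / (64 * Real.exp 4) * (n * α ^ 2) ^ (1 / k - 1)) ≤
      meanRisk Z n α ε k D := by
  have hk0 : 0 < k := by linarith
  set N := n * α ^ 2 with hN
  have hNpos : 0 < N := hκ.trans_le hn
  set c := min κ 1 with hc
  have hcpos : 0 < c := lt_min hκ one_pos
  have hc1 : c ≤ 1 := min_le_right _ _
  have hcN : c / N ≤ 1 := by rw [div_le_one hNpos]; exact (min_le_left _ _).trans hn
  set δ := Real.sqrt (c / N) with hδ
  have hδ0 : 0 < δ := Real.sqrt_pos.2 (by positivity)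
  have hδ1 : δ ≤ 1 := Real.sqrt_le_one.2 hcN
  have hδsq : δ ^ 2 = c / N := Real.sq_sqrt (by positivity)
  have hzero : huber ε (Measure.dirac (0 : ℝ)) (Measure.dirac 0) =
      huber δ (Measure.dirac 0) (Measure.dirac 0) := by
    rw [huber_self hε hε1, huber_self hδ0.le hδ1]
  have hS := (spike_mem_momentClass hk hD hδ0 hδ1).1
  have h := le_minimaxRisk (Z := Z) (n := n) (θ := mean) hα hα1 hδ0.le hδ1
    (dirac_mem_momentClass (a := 0) hk (by rw [abs_zero]; linarith))
    (spike_mem_momentClass hk hD hδ0 hδ1) hzero (huber_self hε hε1 _)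
  refine (ENNReal.ofReal_le_ofReal ?_).trans h
  rw [mean_spike hδ0 hδ1]
  have hexp : 4 * n * δ ^ 2 * α ^ 2 ≤ 4 := by
    calc 4 * n * δ ^ 2 * α ^ 2 = 4 * (c / N * N) := by rw [hδsq, hN]; ring
      _ = 4 * c := by rw [div_mul_cancel₀ _ hNpos.ne']
      _ ≤ 4 := by linarith
  have hpow : c * N ^ (1 / k - 1) ≤ (δ ^ (1 - 1 / k)) ^ 2 := by
    have h1 : (δ ^ (1 - 1 / k)) ^ 2 = c ^ (1 - 1 / k) * N ^ (1 / k - 1) := by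
      rw [← Real.rpow_mul_natCast hδ0.le, mul_comm, Real.rpow_mul hδ0.le, Real.rpow_natCast, hδsq,
        Real.div_rpow hcpos.le hNpos.le, div_eq_mul_inv, ← Real.rpow_neg hNpos.le, neg_sub]
    rw [h1]
    gcongr
    have : 0 < 1 / k := by positivity
    simpa using Real.rpow_le_rpow_of_exponent_ge hcpos hc1 (by linarith : 1 - 1 / k ≤ 1)
  have hm0 : mean (Measure.dirac (0 : ℝ)) = 0 := by simp [mean]
  rw [hm0, zero_sub, neg_sq, div_pow]
  calc c / (64 * Real.exp 4) * N ^ (1 / k - 1)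
      = c * N ^ (1 / k - 1) / 2 ^ 2 / (16 * Real.exp 4) := by field_simp; ring
    _ ≤ _ := by gcongr

end Bounds

end LDPMean

theorem proposition4 :
    -- the three-term bound, with `n * α ^ 2` bounded away from zero
    (∀ κ : ℝ, 0 < κ → ∃ c : ℝ, 0 < c ∧
      ∀ (Z : Type*) [MeasurableSpace Z] (k D α ε : ℝ) (n : ℕ),
        1 < k → 1 ≤ D → 0 < α → α ≤ 1 → 0 ≤ ε → ε ≤ 1 → κ ≤ n * α ^ 2 →
        ENNReal.ofReal (c * max (max ((n * α ^ 2) ^ (1 / k - 1)) (ε ^ (2 - 2 / k)))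
            (D ^ 2 / Real.exp (64 * n * α ^ 2)))
          ≤ LDPMean.meanRisk Z n α ε k D) ∧
    -- the last two terms, with no condition on `n * α ^ 2`
    (∃ c : ℝ, 0 < c ∧
      ∀ (Z : Type*) [MeasurableSpace Z] (k D α ε : ℝ) (n : ℕ),
        1 < k → 1 ≤ D → 0 < α → α ≤ 1 → 0 ≤ ε → ε ≤ 1 → 1 ≤ n →
        ENNReal.ofReal (c * max (ε ^ (2 - 2 / k)) (D ^ 2 / Real.exp (64 * n * α ^ 2)))
          ≤ LDPMean.meanRisk Z n α ε k D) ∧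
    -- the explicit bound without contamination
    (∀ (Z : Type*) [MeasurableSpace Z] (k D α : ℝ) (n : ℕ),
      1 < k → 0 ≤ D → 0 < α → α ≤ 1 → 1 ≤ n →
      ENNReal.ofReal (D ^ 2 / (32 * Real.exp (64 * n * α ^ 2)))
        ≤ LDPMean.meanRisk Z n α 0 k D) := by
  -- the exponent `64` of the statement leaves room for the exponent `4` of `range_le_meanRisk`
  have hexp : ∀ (D α b c : ℝ) (n : ℕ), c ≤ 1 / b → 0 < b →
      c * (D ^ 2 / Real.exp (64 * n * α ^ 2)) ≤ D ^ 2 / (b * Real.exp (4 * n * α ^ 2)) := by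
    intro D α b c n hcb hb
    have hle : Real.exp (4 * n * α ^ 2) ≤ Real.exp (64 * n * α ^ 2) := by
      gcongr; norm_num
    calc c * (D ^ 2 / Real.exp (64 * n * α ^ 2))
        ≤ 1 / b * (D ^ 2 / Real.exp (4 * n * α ^ 2)) := by gcongr
      _ = _ := by field_simp
  refine ⟨fun κ hκ => ⟨min κ 1 / (64 * Real.exp 4), by positivity, ?_⟩,
    ⟨1 / 64, by norm_num, ?_⟩, ?_⟩
  · intro Z _ k D α ε n hk hD hα hα1 hε hε1 hn
    have hc0 : 0 ≤ min κ 1 / (64 * Real.exp 4) := by positivity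
    have hc : min κ 1 / (64 * Real.exp 4) ≤ 1 / 64 := by
      have := Real.one_le_exp (show (0 : ℝ) ≤ 4 by norm_num)
      gcongr
      · exact min_le_right _ _
      · linarith
    rw [mul_max_of_nonneg _ _ hc0, mul_max_of_nonneg _ _ hc0, ENNReal.ofReal_max,
      ENNReal.ofReal_max]
    refine max_le (max_le ?_ ?_) ?_
    · exact LDPMean.privacy_le_meanRisk hκ hk hD hα.le hα1 hε hε1 hn
    · refine (ENNReal.ofReal_le_ofReal ?_).trans
        (LDPMean.contamination_le_meanRisk hk hD hα.le hα1 hε hε1)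
      calc min κ 1 / (64 * Real.exp 4) * ε ^ (2 - 2 / k) ≤ 1 / 64 * ε ^ (2 - 2 / k) := by gcongr
        _ = _ := by ring
    · exact (ENNReal.ofReal_le_ofReal (hexp D α 4 _ n (by linarith) (by norm_num))).trans
        (LDPMean.range_le_meanRisk hk (by linarith) hα.le hα1 hε hε1)
  · intro Z _ k D α ε n hk hD hα hα1 hε hε1 _
    rw [mul_max_of_nonneg _ _ (by norm_num), ENNReal.ofReal_max]
    refine max_le ?_ ?_
    · rw [one_div_mul_eq_div]
      exact LDPMean.contamination_le_meanRisk hk hD hα.le hα1 hε hε1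
    · exact (ENNReal.ofReal_le_ofReal
        (hexp D α 4 _ n (by norm_num) (by norm_num))).trans
        (LDPMean.range_le_meanRisk hk (by linarith) hα.le hα1 hε hε1)
  · intro Z _ k D α n hk hD hα hα1 _
    refine (ENNReal.ofReal_le_ofReal ?_).trans
      (LDPMean.range_le_meanRisk hk hD hα.le hα1 le_rfl zero_le_one)
    calc D ^ 2 / (32 * Real.exp (64 * n * α ^ 2))
        = 1 / 32 * (D ^ 2 / Real.exp (64 * n * α ^ 2)) := by field_simp
      _ ≤ _ := hexp D α 4 _ n (by norm_num) (by norm_num)
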